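/- **Words.** Fix an alphabet $\Sigma$. For $L\subseteq\Sigma^\omega$ and $p\in\Sigma^*$ let $L^{\mathrm{suff}}(p)=\{w\in\Sigma^\omega : p\cdot w\in L\}$. For $w=w_0w_1\ldots\in\Sigma^\omega$ and an infinite set $J=\{j_1<j_2<\dots\}\subseteq\mathbb N$, a word $w'$ is a *suffix-language-preserving injection* into $w$ at $J$ (with respect to $L$), written $\mathrm{SLII}^L_{J,w}\,w'$, if $w'=w_0\ldots w_{j_1-1}u_1w_{j_1}\ldots w_{j_2-1}u_2w_{j_2}\ldots$ with $u_i\in\Sigma^*$ and $L^{\mathrm{suff}}(w_0\ldots w_{j_i-1}u_i)=L^{\mathrm{suff}}(w_0\ldots w_{j_i-1})$ for all $i$. Put $L^0=\Sigma^\omega$ and, for $i\ge1$, $$L^i=\{w\in L^{i-1} : \forall J\ \exists\,\mathrm{SLII}^L_{J,w}\,w' :\ w'\in L^{i-1}\cap \hat L_i\},$$ where $\hat L_i=\overline L$ for odd $i$, $\hat L_i=L$ for even $i$, and $J$ ranges over the infinite subsets of $\mathbb N$. The *natural color* of $w$ with respect to $L$ is the largest $i$ with $w\in L^i$. **Automata.**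 Let $\mathcal A=(\Sigma,Q,q_0,\delta,F)$ be a weak alternating Büchi automaton with finite state set $Q$: $\delta(q,x)$ is a positive Boolean formula over $Q$ in conjunctive normal form without the constants true and false, and there is a total preorder on $Q$ such that every $q'$ occurring in $\delta(q,x)$ satisfies $q'\le q$ and equivalent states are all accepting or all rejecting. In the game on $w=w_0w_1\ldots$, in state $q_i$ the rejector picks a clause of $\delta(q_i,w_i)$ and the acceptor picks the next state in it, starting in $q_0$; the acceptor wins a play if from some moment on it visits only states of $F$. The word $w$ belongs to $L(\mathcal A)$ if the rejector has no strategy that wins against every acceptor strategy. Let $\overline{\mathcal A}$ be the dual automaton (dualized transition formulas in conjunctive normal form, accepting set $Q\setminus F$). For $\ell\ge1$ let the *obligation graph* $\mathcal G_\ell$ be the nondeterministic Büchi automaton obtained by the Miyano–Hayashi breakpoint construction from $\overline{\mathcal A}$ if $\ell$ is odd, and from $\mathcal A$ if $\ell$ is even. **Suffix-language tracking machine.** Let $\mathcal M$ be a canonical suffix-language tracking machine of $L(\mathcal A)$: a deterministic Moore machine with states $Q^S$, initial state $q_0^S$, transition function $\delta^S$, and labels which are suffix languages of $L(\mathcal A)$,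 distinct states having distinct labels, such that for every $p\in\Sigma^*$ the label of the state $\delta^S(q_0^S,p)$ is $L(\mathcal A)^{\mathrm{suff}}(p)$. To $s\in Q^S$ and $\ell$ it attaches the set $\lambda^\ell(s)$ of all vertices of $\mathcal G_\ell$ in which some run of $\mathcal G_\ell$ ends after reading some $p$ from the initial vertex, where $L(\mathcal A)^{\mathrm{suff}}(p)$ is the label of $s$. **Floating automata.** A nondeterministic floating automaton over $\mathcal M$ has states $P$, a transition relation $\subseteq P\times\Sigma\times P$ and a labelling $f:P\to Q^S$ with $f(q')=\delta^S(f(q),x)$ for every transition $(q,x,q')$; it is deterministic (a DFW) if each $(q,x)$ has at most one successor. It accepts $w_0w_1\ldots$ if for some $m\in\mathbb N$ there is an infinite path on $w_mw_{m+1}\ldots$ whose first state is labelled $\delta^S(q_0^S,w_0\ldots w_{m-1})$. Given $\ell\ge 1$ and a DFW $\mathcal F^{\ell-1}$ over $\mathcal M$ with finite state set and labelling $f^{\ell-1}$, let $\mathcal F^\ell_N$ be the nondeterministic floating automaton obtained as follows. Take the product of $\mathcal F^{\ell-1}$ and $\mathcal G_\ell$ on the states $(q,v)$ with $v\in\lambda^\ell(f^{\ell-1}(q))$,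 labelled $f^{\ell-1}(q)$; remove the transient states and transitions; and keep exactly those maximal strongly connected components that contain a state $(q,v)$ with $v$ accepting in $\mathcal G_\ell$. **Lemma.** 1. For every $\ell\ge1$ and every finite DFW $\mathcal F^{\ell-1}$ over $\mathcal M$, $$\{w\in\Sigma^\omega : \forall J\ \exists\,\mathrm{SLII}^{L(\mathcal A)}_{J,w}\,w' :\ w'\in L(\mathcal F^{\ell-1})\cap L(\mathcal G_\ell)\}\ \subseteq\ L(\mathcal F^\ell_N).$$ 2. Let $\ell\ge1$ and let $\mathcal F^0,\dots,\mathcal F^{\ell-1}$ be finite DFWs over $\mathcal M$ such that $L(\mathcal F^0)=\Sigma^\omega$ and, for $1\le i<\ell$, $\mathcal F^i$ is equivalent to (for example, a minimization of) the determinization of $\mathcal F^i_N$, where $\mathcal F^i_N$ is built from $\mathcal F^{i-1}$ and the determinization is the union of the subset constructions started in the individual states of $\mathcal F^i_N$. Then every word of natural color at least $\ell$ with respect to $L(\mathcal A)$ is accepted by $\mathcal F^\ell_N$. In particular this holds for every $\ell\le k$, where $k$ is the number of levels of the canonical chain of co-Büchi automata of $L(\mathcal A)$. -/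

import Mathlib

namespace Cocoa

/-! ## Words, suffix languages, injections, natural colors -/

/-- The prefix `w 0 ⋯ w (n-1)` of length `n` of an infinite word. -/
def pref {α : Type*} (w : ℕ → α) (n : ℕ) : List α := (List.range n).map w

/-- The word `p · w`. -/
def prepend {α : Type*} (p : List α) (w : ℕ → α) : ℕ → α :=
  fun n => if h : n < p.length then p[n] else w (n - p.length)

/-- The suffix language of `L` after reading `p`. -/
def suffixLang {α : Type*} (L : Set (ℕ → α)) (p : List α) : Set (ℕ → α) :=
  {w | prepend p w ∈ L}

/-- The finite word `u 0 · w 0 · u 1 · w 1 ⋯ u (n-1) · w (n-1)`. -/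
def injected {α : Type*} (w : ℕ → α) (u : ℕ → List α) (n : ℕ) : List α :=
  (List.range n).flatMap (fun j => u j ++ [w j])

/-- `w'` is the result of a suffix-language-preserving injection (with respect to `L`) into `w`
at the positions `J`: for every `j ∈ J` a word `u j` that preserves the suffix language of
`w 0 ⋯ w (j-1)` is inserted immediately before the letter `w j`. -/
def IsSLII {α : Type*} (L : Set (ℕ → α)) (J : Set ℕ) (w w' : ℕ → α) : Prop :=
  ∃ u : ℕ → List α,
    (∀ j, j ∉ J → u j = []) ∧
    (∀ j ∈ J, suffixLang L (pref w j ++ u j) = suffixLang L (pref w j)) ∧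
    ∀ n, pref w' (injected w u n).length = injected w u n

/-- The language `Lⁱ` of the `i`-th level of the canonical chain of co-Büchi languages of `L`. -/
def level {α : Type*} (L : Set (ℕ → α)) : ℕ → Set (ℕ → α)
  | 0 => Set.univ
  | i + 1 => {w | w ∈ level L i ∧ ∀ J : Set ℕ, J.Infinite →
      ∃ w', IsSLII L J w w' ∧ w' ∈ level L i ∧ w' ∈ (if Odd (i + 1) then Lᶜ else L)}

/-- The natural color of `w` with respect to `L`: the largest `i` with `w ∈ Lⁱ`. -/
noncomputable def naturalColor {α : Type*} (L : Set (ℕ → α)) (w : ℕ → α) : ℕ∞ :=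
  ⨆ i ∈ {i : ℕ | w ∈ level L i}, (i : ℕ∞)

/-! ## Weak alternating automata -/

/-- Weak alternating Büchi automata. `trans q x` is a positive Boolean formula in conjunctive
normal form, given as its set of clauses; the constants `true` (no clause) and `false`
(an empty clause) do not occur. -/
structure WAA (α Q : Type*) where
  init : Q
  trans : Q → α → Set (Set Q)
  acc : Set Q
  trans_nonempty : ∀ q x, (trans q x).Nonempty
  clause_nonempty : ∀ q x, ∀ c ∈ trans q x, c.Nonempty
  weak : ∃ le : Q → Q → Prop,
    (∀ p q, le p q ∨ le q p) ∧ (∀ p q r, le p q → le q r → le p r) ∧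
    (∀ q x, ∀ c ∈ trans q x, ∀ q' ∈ c, le q' q) ∧
    (∀ p q, le p q → le q p → (p ∈ acc ↔ q ∈ acc))

namespace WAA

variable {α Q : Type*} (A : WAA α Q)

/-- A strategy of the rejector on the word `w` maps the nonempty sequence of states visited so
far to a clause of the current transition formula. -/
def IsRejStrategy (w : ℕ → α) (R : List Q → Set Q) : Prop :=
  ∀ (h : List Q) (q : Q), R (h ++ [q]) ∈ A.trans q (w h.length)

/-- A strategy of the acceptor maps the sequence of clauses picked so far to a state of the last
clause. -/
def IsAccStrategy (C : List (Set Q) → Q) : Prop :=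
  ∀ (cs : List (Set Q)) (c : Set Q), c.Nonempty → C (cs ++ [c]) ∈ c

/-- The states visited and the clauses picked during the first `n` rounds. -/
def history (R : List Q → Set Q) (C : List (Set Q) → Q) : ℕ → List Q × List (Set Q)
  | 0 => ([A.init], [])
  | n + 1 =>
    ((history R C n).1 ++ [C ((history R C n).2 ++ [R (history R C n).1])],
      (history R C n).2 ++ [R (history R C n).1])

/-- The `n`-th state of the play induced by two strategies. -/
def play (R : List Q → Set Q) (C : List (Set Q) → Q) (n : ℕ) : Q :=
  (A.history R C n).1.getLastD A.init

/-- The words on which the rejector has no strategy that wins against every acceptor strategy;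
the acceptor wins a play if from some moment on it visits accepting states only. -/
def language : Set (ℕ → α) :=
  {w | ¬ ∃ R, A.IsRejStrategy w R ∧
    ∀ C, IsAccStrategy C → ¬ ∃ N, ∀ n ≥ N, A.play R C n ∈ A.acc}

/-- The dual automaton, which recognizes the complement: accepting and rejecting states are
swapped, and every formula `⋀ d, ⋁ q ∈ d, q` is replaced by the conjunctive normal form
`⋀ g, ⋁ d, g d` of `⋁ d, ⋀ q ∈ d, q`, where `g` ranges over the choice functions of the clauses. -/
def dual : WAA α Q where
  init := A.init
  trans q x := {c | ∃ g : Set Q → Q, (∀ d ∈ A.trans q x, g d ∈ d) ∧ c = g '' A.trans q x}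
  acc := A.accᶜ
  trans_nonempty q x := by
    classical
    refine ⟨_, fun d => if h : d.Nonempty then h.some else A.init, fun d hd => ?_, rfl⟩
    have h := A.clause_nonempty q x d hd
    simpa [h] using h.some_mem
  clause_nonempty q x c hc := by
    obtain ⟨g, -, rfl⟩ := hc
    exact (A.trans_nonempty q x).image g
  weak := by
    obtain ⟨le, h1, h2, h3, h4⟩ := A.weak
    refine ⟨le, h1, h2, ?_, fun p q hpq hqp => not_congr (h4 p q hpq hqp)⟩
    rintro q x c ⟨g, hg, rfl⟩ q' ⟨d, hd, rfl⟩
    exact h3 q x d hd _ (hg d hd)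

end WAA

/-! ## Nondeterministic Büchi automata and obligation graphs -/

/-- Nondeterministic (state-based) Büchi automata. -/
structure NBW (α V : Type*) where
  init : Set V
  step : V → α → Set V
  acc : Set V

namespace NBW

variable {α V : Type*} (G : NBW α V)

/-- The vertices in which a run can end after reading `p` from an initial vertex. -/
def reach (p : List α) : Set V :=
  p.foldl (fun T x => {v' | ∃ v ∈ T, v' ∈ G.step v x}) G.init

def language : Set (ℕ → α) :=
  {w | ∃ r : ℕ → V, r 0 ∈ G.init ∧ (∀ i, r (i + 1) ∈ G.step (r i) (w i)) ∧
    ∀ N, ∃ n ≥ N, r n ∈ G.acc}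

end NBW

namespace WAA

variable {α Q : Type*} (A : WAA α Q)

/-- `T` satisfies the formulas `trans q x` for all `q ∈ S`. -/
def Sat (S : Set Q) (x : α) (T : Set Q) : Prop :=
  ∀ q ∈ S, ∀ c ∈ A.trans q x, (T ∩ c).Nonempty

/-- The breakpoint construction of Miyano and Hayashi. In a vertex `(S, O)`, `S` is the current
level of the run and `O ⊆ S` holds the states that still owe a visit to an accepting state. -/
def miyanoHayashi : NBW α (Set Q × Set Q) where
  init := {({A.init}, ∅)}
  step v x := {v' | A.Sat v.1 x v'.1 ∧
    ((v.2 = ∅ ∧ v'.2 = v'.1 \ A.acc) ∨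
      (v.2 ≠ ∅ ∧ ∃ O ⊆ v'.1, A.Sat v.2 x O ∧ v'.2 = O \ A.acc))}
  acc := {v | v.2 = ∅}

/-- The obligation graph used at level `ℓ`: it recognizes the complement of the language of `A`
for odd `ℓ`, and the language of `A` for even `ℓ`. -/
def obligationGraph (ℓ : ℕ) : NBW α (Set Q × Set Q) :=
  if Odd ℓ then A.dual.miyanoHayashi else A.miyanoHayashi

end WAA

/-! ## Suffix-language tracking machines -/

/-- Suffix-language tracking machines of `L`: Moore machines over the suffix languages of `L`
that output the suffix language of the prefix read so far. -/
structure SLTM {α : Type*} (L : Set (ℕ → α)) (S : Type*) where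
  init : S
  step : S → α → S
  label : S → Set (ℕ → α)
  label_mem : ∀ s, ∃ p, label s = suffixLang L p
  label_run : ∀ p : List α, label (p.foldl step init) = suffixLang L p

namespace SLTM

variable {α S : Type*} {L : Set (ℕ → α)} (M : SLTM L S)

/-- The state reached after reading `p`. -/
def run (p : List α) : S := p.foldl M.step M.init

/-- The set of vertices of the obligation graph `G` that is attached to the state `s`: all
vertices reached in `G` by a prefix whose suffix language is the label of `s`. -/
def vertices {V : Type*} (G : NBW α V) (s : S) : Set V :=
  {v | ∃ p : List α, suffixLang L p = M.label s ∧ v ∈ G.reach p}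

/-- Canonical machines. If states are identified with their sets `vertices G s` of vertices of an
obligation graph, then a state is determined by its label; this is what is required here, so that
one abstract state space serves the obligation graphs of `L` and of its complement. -/
def IsCanonical : Prop := Function.Injective M.label

end SLTM

theorem prepend_append_singleton {α : Type*} (p : List α) (x : α) (w : ℕ → α) :
    prepend (p ++ [x]) w = prepend p (prepend [x] w) := by
  funext n
  simp only [prepend, List.length_append, List.length_singleton]
  rcases lt_trichotomy n p.length with h | h | h
  · simp [h, Nat.lt_succ_of_lt h]
  · subst h; simp
  · have h1 : ¬ n < p.length := by omega
    have h2 : ¬ n < p.length + 1 := by omega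
    have h3 : ¬ n - p.length < 1 := by omega
    simp only [h1, h2, h3, dite_false]
    congr 1

theorem prepend_nil {α : Type*} (w : ℕ → α) : prepend [] w = w := by
  funext n; simp [prepend]

/-- The canonical machine of `L` whose states are the suffix languages themselves. -/
def suffixSLTM {α : Type*} (L : Set (ℕ → α)) :
    SLTM L {K : Set (ℕ → α) // ∃ p, K = suffixLang L p} where
  init := ⟨L, [], by ext w; simp [suffixLang, prepend_nil]⟩
  step K x := ⟨suffixLang K.1 [x], by
    obtain ⟨K, p, rfl⟩ := K
    exact ⟨p ++ [x], by ext w; simp [suffixLang, prepend_append_singleton]⟩⟩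
  label := Subtype.val
  label_mem s := s.2
  label_run p := by
    induction p using List.reverseRecOn with
    | nil => ext w; simp [suffixLang, prepend_nil]
    | append_singleton p x ih =>
      rw [List.foldl_append, List.foldl_cons, List.foldl_nil]
      simp only [ih]
      ext w
      simp [suffixLang, prepend_append_singleton]

theorem suffixSLTM_isCanonical {α : Type*} (L : Set (ℕ → α)) : (suffixSLTM L).IsCanonical :=
  Subtype.val_injective

/-! ## Floating automata -/

/-- Nondeterministic floating automata with state space `P` over the machine `M`. -/
structure NFW {α S : Type*} {L : Set (ℕ → α)} (M : SLTM L S) (P : Type*) where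
  trans : P → α → P → Prop
  label : P → S
  label_trans : ∀ q x q', trans q x q' → label q' = M.step (label q) x

/-- Deterministic floating automata: the transition function is partial. -/
structure DFW {α S : Type*} {L : Set (ℕ → α)} (M : SLTM L S) (P : Type*) where
  delta : P → α → Option P
  label : P → S
  label_delta : ∀ q x q', delta q x = some q' → label q' = M.step (label q) x

/-- A word is accepted if from some moment `m` on there is an infinite path, reading the rest of
the word, whose first state is labelled with the state that `M` has reached at this moment. -/
def NFW.language {α S P : Type*} {L : Set (ℕ → α)} {M : SLTM L S} (N : NFW M P) :
    Set (ℕ → α) :=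
  {w | ∃ (m : ℕ) (r : ℕ → P), N.label (r 0) = M.run (pref w m) ∧
    ∀ i, N.trans (r i) (w (m + i)) (r (i + 1))}

def DFW.toNFW {α S P : Type*} {L : Set (ℕ → α)} {M : SLTM L S} (F : DFW M P) : NFW M P where
  trans q x q' := F.delta q x = some q'
  label := F.label
  label_trans := F.label_delta

def DFW.language {α S P : Type*} {L : Set (ℕ → α)} {M : SLTM L S} (F : DFW M P) :
    Set (ℕ → α) :=
  F.toNFW.language

/-! ### The product with an obligation graph -/

section Product

variable {α S P V : Type*} {L : Set (ℕ → α)} {M : SLTM L S} (F : DFW M P) (G : NBW α V)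

/-- States of the unabridged product. -/
abbrev ProdState : Type _ := {s : P × V // s.2 ∈ M.vertices G (F.label s.1)}

/-- Transitions of the unabridged product. -/
def prodTrans (s : ProdState F G) (x : α) (t : ProdState F G) : Prop :=
  F.delta s.1.1 x = some t.1.1 ∧ t.1.2 ∈ G.step s.1.2 x

/-- Edges of the graph of the unabridged product. -/
def prodEdge (s t : ProdState F G) : Prop := ∃ x, prodTrans F G s x t

/-- `s` and `t` lie in the same maximal strongly connected component of the product. -/
def SameSCC (s t : ProdState F G) : Prop :=
  Relation.ReflTransGen (prodEdge F G) s t ∧ Relation.ReflTransGen (prodEdge F G) t s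

/-- The states that are kept: they are not transient (they lie on a cycle), and their maximal
strongly connected component contains a state whose vertex is accepting in `G`. -/
def Kept (s : ProdState F G) : Prop :=
  Relation.TransGen (prodEdge F G) s s ∧ ∃ t, SameSCC F G s t ∧ t.1.2 ∈ G.acc

/-- The product of `F` and `G` without transient states and transitions, restricted to the
maximal strongly connected components that contain a `G`-accepting vertex. -/
def productNFW : NFW M {s : ProdState F G // Kept F G s} where
  trans s x t := prodTrans F G s.1 x t.1 ∧ SameSCC F G s.1 t.1
  label s := F.label s.1.1.1
  label_trans _ _ _ h := F.label_delta _ _ _ h.1.1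

end Product

/-- The nondeterministic floating automaton of level `ℓ`, built from a deterministic floating
automaton `F` for level `ℓ - 1`. -/
def WAA.floatN {α Q S P : Type*} (A : WAA α Q) {M : SLTM A.language S} (ℓ : ℕ) (F : DFW M P) :
    NFW M {s : ProdState F (A.obligationGraph ℓ) // Kept F (A.obligationGraph ℓ) s} :=
  productNFW F (A.obligationGraph ℓ)

/-! ### Determinization -/

namespace NFW

variable {α S P : Type*} {L : Set (ℕ → α)} {M : SLTM L S} (N : NFW M P)

def post (T : Set P) (x : α) : Set P := {q' | ∃ q ∈ T, N.trans q x q'}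

theorem label_of_mem_post (q : P) (p : List α) :
    ∀ q' ∈ p.foldl N.post {q}, N.label q' = p.foldl M.step (N.label q) := by
  induction p using List.reverseRecOn with
  | nil => intro q' h; simp at h; simp [h]
  | append_singleton p x ih =>
    intro q' h
    rw [List.foldl_append, List.foldl_cons, List.foldl_nil] at h ⊢
    obtain ⟨q'', h1, h2⟩ := h
    rw [N.label_trans _ _ _ h2, ih _ h1]

/-- The nonempty sets of states reachable in the subset construction from a singleton. -/
abbrev DetState : Type _ := {T : Set P // T.Nonempty ∧ ∃ (q : P) (p : List α), T = p.foldl N.post {q}}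

open Classical in
/-- Determinization: the union, over all states `q`, of the subset constructions started in `q`.
A transition to the empty set is undefined. All elements of a state carry the same label, which
is the label of the state. -/
noncomputable def det : DFW M N.DetState where
  delta T x :=
    if h : (N.post T.1 x).Nonempty then
      some ⟨N.post T.1 x, h, by
        obtain ⟨T, -, q, p, rfl⟩ := T
        exact ⟨q, p ++ [x], by simp⟩⟩
    else none
  label T := N.label T.2.1.some
  label_delta := by
    rintro ⟨T, hT, q, p, rfl⟩ x ⟨T', hT', h'⟩ h
    split_ifs at h with hne
    have hT'' : T' = (p ++ [x]).foldl N.post {q} := by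
      simpa using (congrArg Subtype.val (Option.some.inj h)).symm
    subst hT''
    rw [N.label_of_mem_post q _ _ hT'.some_mem, N.label_of_mem_post q _ _ hT.some_mem]
    simp

end NFW

/-- `F 0, …, F n` are deterministic floating automata produced level by level: `F 0` recognizes
all words, and `F (i + 1)` is an automaton equivalent to the determinization of the
nondeterministic floating automaton of level `i + 1` built from `F i`
(for example, a minimal one). -/
def IsLevelChain {α Q S : Type*} {P : ℕ → Type*} (A : WAA α Q) (M : SLTM A.language S)
    (F : ∀ i, DFW M (P i)) (n : ℕ) : Prop :=
  (F 0).language = Set.univ ∧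
    ∀ i < n, (F (i + 1)).language = (A.floatN (i + 1) (F i)).det.language

end Cocoa

namespace Cocoa

open Filter

/-! ## Words -/

/-! Claim 1 (`injectable_subset_productNFW_language`). Suppose the product automaton rejects `w`. It
is finite, so by compactness every position `m` has a bound `K m` such that no path whose first
label fits the prefix of length `m` survives `K m` letters. Choose injection positions `n` with gaps
larger than `K n`. The injected word has a product run whose vertices are eventually recurrent,
hence lie in a kept component. The injections preserve suffix languages, so after a late injection
before `w n` the run carries the label that `w` has at `n`. It then reads `K n` uninterrupted
letters of `w`, a contradiction.

Claim 2 is an induction over the levels, resting on claim 1 and two inclusions: determinization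
loses no words, and an obligation graph accepts every word it should
(`subset_obligationGraph_language`). For the latter, consider the positions that the rejector does
not win. From there, every clause contains a state from which the acceptor forces an accepting state
in boundedly many rounds without leaving these positions; otherwise the rejector could avoid such
states forever or reach a position it wins. The bounds make the breakpoint sets run empty again and
again. For odd levels, weakness shows that the rejector cannot win both the game and its dual. -/

theorem pref_succ {α : Type*} (w : ℕ → α) (n : ℕ) : pref w (n + 1) = pref w n ++ [w n] := by
  simp [pref, List.range_succ]

@[simp] theorem length_pref {α : Type*} (w : ℕ → α) (n : ℕ) : (pref w n).length = n := by
  simp [pref]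

theorem pref_succ_eq_cons {α : Type*} (w : ℕ → α) (n : ℕ) :
    pref w (n + 1) = w 0 :: pref (fun i => w (i + 1)) n := by
  simp [pref, List.range_succ_eq_map, Function.comp_def]

theorem pref_eq_of_append {α : Type*} {w : ℕ → α} {n : ℕ} {p q : List α}
    (h : pref w n = p ++ q) : pref w p.length = p := by
  induction q using List.reverseRecOn generalizing n with
  | nil =>
    have := congrArg List.length h
    simp at this
    simpa [this] using h
  | append_singleton q x ih =>
    cases n with
    | zero =>
      have := congrArg List.length h
      simp at this
    | succ n =>
      rw [pref_succ, ← List.append_assoc] at h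
      exact ih (List.append_inj' h rfl).1

theorem prepend_append {α : Type*} (p q : List α) (w : ℕ → α) :
    prepend (p ++ q) w = prepend p (prepend q w) := by
  induction q using List.reverseRecOn generalizing w with
  | nil => simp [prepend_nil]
  | append_singleton q x ih =>
    rw [← List.append_assoc, prepend_append_singleton, ih, ← prepend_append_singleton]

theorem suffixLang_append {α : Type*} (L : Set (ℕ → α)) (p q : List α) :
    suffixLang L (p ++ q) = suffixLang (suffixLang L p) q := by
  ext w; simp [suffixLang, prepend_append]

/-- This is where canonicity enters: an insertion that preserves the suffix language also preserves
the state of `M`. -/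
theorem SLTM.IsCanonical.run_eq {α S : Type*} {L : Set (ℕ → α)} {M : SLTM L S}
    (hM : M.IsCanonical) {p q : List α} (h : suffixLang L p = suffixLang L q) :
    M.run p = M.run q :=
  hM ((M.label_run p).trans (h.trans (M.label_run q).symm))

/-! ## Injections -/

section Injection

variable {α : Type*} {w w' : ℕ → α} {u : ℕ → List α}

theorem injected_succ (w : ℕ → α) (u : ℕ → List α) (n : ℕ) :
    injected w u (n + 1) = (injected w u n ++ u n) ++ [w n] := by
  simp [injected, List.range_succ, List.flatMap_append]

theorem le_length_injected (w : ℕ → α) (u : ℕ → List α) (n : ℕ) :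
    n ≤ (injected w u n).length := by
  induction n with
  | zero => simp
  | succ n ih => rw [injected_succ]; simp; omega

/-- Suffix languages form a right congruence, so each insertion is invisible to everything after it.
-/
theorem suffixLang_injected {L : Set (ℕ → α)}
    (hu : ∀ n, suffixLang L (pref w n ++ u n) = suffixLang L (pref w n)) (n : ℕ) :
    suffixLang L (injected w u n) = suffixLang L (pref w n) := by
  induction n with
  | zero => simp [injected, pref]
  | succ n ih =>
    rw [injected_succ, pref_succ, suffixLang_append L (_ ++ _), suffixLang_append L _ (u n), ih,
      ← suffixLang_append L _ (u n), hu, ← suffixLang_append]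

/-- The position in the injected word of the letter `w n`. -/
def injPos (w : ℕ → α) (u : ℕ → List α) (n : ℕ) : ℕ := (injected w u n ++ u n).length

theorem le_injPos (w : ℕ → α) (u : ℕ → List α) (n : ℕ) : n ≤ injPos w u n := by
  have := le_length_injected w u n
  simp [injPos]; omega

theorem pref_injPos (h : ∀ n, pref w' (injected w u n).length = injected w u n) (n : ℕ) :
    pref w' (injPos w u n) = injected w u n ++ u n :=
  pref_eq_of_append ((h (n + 1)).trans (injected_succ w u n))

theorem apply_injPos (h : ∀ n, pref w' (injected w u n).length = injected w u n) (n : ℕ) :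
    w' (injPos w u n) = w n := by
  have h1 := h (n + 1)
  have h2 : (injected w u (n + 1)).length = injPos w u n + 1 := by
    rw [injected_succ, List.length_append]; rfl
  rw [h2, pref_succ, injected_succ] at h1
  simpa using (List.append_inj' h1 rfl).2

/-- The case `t = 0` is left free: a word may be inserted before `w n` itself, and the letters from
`w n` on still stay contiguous. -/
theorem injPos_add (n k : ℕ) (hu : ∀ t, 0 < t → t ≤ k → u (n + t) = []) :
    injPos w u (n + k) = injPos w u n + k := by
  induction k with
  | zero => rfl
  | succ k ih =>
    have h1 := ih fun t h0 ht => hu t h0 (by omega)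
    have h2 : injPos w u (n + k + 1) = injPos w u (n + k) + 1 := by
      have := hu (k + 1) (by omega) le_rfl
      rw [← add_assoc] at this
      simp [injPos, injected_succ, this]
      omega
    rw [← add_assoc, h2, h1]; omega

end Injection

/-! ## Infinite paths in finite graphs -/

/-- König's lemma as compactness: the paths that are valid for `k` steps form a decreasing sequence
of nonempty closed subsets of the compact space `ℕ → P`. -/
theorem exists_infinite_path {P : Type*} [Finite P] (R : ℕ → P → P → Prop) (I : Set P)
    (h : ∀ k : ℕ, ∃ r : ℕ → P, r 0 ∈ I ∧ ∀ i < k, R i (r i) (r (i + 1))) :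
    ∃ r : ℕ → P, r 0 ∈ I ∧ ∀ i, R i (r i) (r (i + 1)) := by
  let _ : TopologicalSpace P := ⊥
  have : DiscreteTopology P := ⟨rfl⟩
  have hcl : ∀ k, IsClosed {r : ℕ → P | r 0 ∈ I ∧ ∀ i < k, R i (r i) (r (i + 1))} := by
    intro k
    have h0 : IsClosed {r : ℕ → P | r 0 ∈ I} :=
      (isClosed_discrete I).preimage (continuous_apply 0)
    have h1 : ∀ i, IsClosed {r : ℕ → P | R i (r i) (r (i + 1))} := fun i =>
      IsClosed.preimage (f := fun r : ℕ → P => (r i, r (i + 1)))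
        ((continuous_apply i).prodMk (continuous_apply (i + 1)))
        (isClosed_discrete {x : P × P | R i x.1 x.2})
    have h2 : {r : ℕ → P | r 0 ∈ I ∧ ∀ i < k, R i (r i) (r (i + 1))} =
        {r : ℕ → P | r 0 ∈ I} ∩ ⋂ i, ⋂ _ : i < k, {r : ℕ → P | R i (r i) (r (i + 1))} := by
      ext r; simp
    rw [h2]
    exact h0.inter (isClosed_iInter fun i => isClosed_iInter fun _ => h1 i)
  obtain ⟨r, hr⟩ := IsCompact.nonempty_iInter_of_sequence_nonempty_isCompact_isClosed
    (fun k : ℕ => {r : ℕ → P | r 0 ∈ I ∧ ∀ i < k, R i (r i) (r (i + 1))})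
    (fun k r hr => ⟨hr.1, fun i hi => hr.2 i (by omega)⟩) h (hcl 0).isCompact hcl
  rw [Set.mem_iInter] at hr
  exact ⟨r, (hr 0).1, fun i => (hr (i + 1)).2 i (by omega)⟩

theorem eventually_recurrent {X : Type*} [Finite X] (s : ℕ → X) :
    ∀ᶠ i in atTop, ∃ᶠ j in atTop, s j = s i := by
  have : ∀ᶠ i in atTop, ∀ x, s i = x → ∃ᶠ j in atTop, s j = x := by
    refine eventually_all.2 fun x => ?_
    by_cases hx : ∃ᶠ j in atTop, s j = x
    · exact Eventually.of_forall fun _ _ => hx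
    · exact (not_frequently.1 hx).mono fun i hi h => absurd h hi
  exact this.mono fun i hi => hi _ rfl

theorem NFW.exists_bound_of_notMem_language {α S P : Type*} [Finite P] {L : Set (ℕ → α)}
    {M : SLTM L S} (N : NFW M P) {w : ℕ → α} (hw : w ∉ N.language) (m : ℕ) :
    ∃ k : ℕ, ∀ r : ℕ → P, N.label (r 0) = M.run (pref w m) →
      ¬ ∀ i < k, N.trans (r i) (w (m + i)) (r (i + 1)) := by
  by_contra! h
  obtain ⟨r, h0, h1⟩ := exists_infinite_path (fun i p q => N.trans p (w (m + i)) q)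
    {p | N.label p = M.run (pref w m)} h
  exact hw ⟨m, r, h0, h1⟩

/-! ## The product with an obligation graph -/

theorem NBW.mem_reach_of_run {α V : Type*} {G : NBW α V} {w : ℕ → α} {v : ℕ → V}
    (h0 : v 0 ∈ G.init) (h1 : ∀ i, v (i + 1) ∈ G.step (v i) (w i)) (n : ℕ) :
    v n ∈ G.reach (pref w n) := by
  induction n with
  | zero => simpa [NBW.reach, pref] using h0
  | succ n ih =>
    rw [NBW.reach, pref_succ, List.foldl_append]
    exact ⟨v n, ih, h1 n⟩

theorem SLTM.run_pref_succ {α S : Type*} {L : Set (ℕ → α)} (M : SLTM L S) (w : ℕ → α) (n : ℕ) :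
    M.run (pref w (n + 1)) = M.step (M.run (pref w n)) (w n) := by
  simp [SLTM.run, pref_succ]

section Product

variable {α S P V : Type*} {L : Set (ℕ → α)} {M : SLTM L S} {F : DFW M P} {G : NBW α V}

/-- Acceptance by `F` starts at time `m`, the run of `G` at time 0. The vertex at time `m + i` is
admissible because the prefix of that length reaches it and has the right suffix language. -/
theorem exists_prod_run {w : ℕ → α} (hF : w ∈ F.language) (hG : w ∈ G.language) :
    ∃ (m : ℕ) (s : ℕ → ProdState F G), (∀ i, F.label (s i).1.1 = M.run (pref w (m + i))) ∧
      (∀ i, prodTrans F G (s i) (w (m + i)) (s (i + 1))) ∧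
      ∃ᶠ i in atTop, (s i).1.2 ∈ G.acc := by
  obtain ⟨m, r, hr0, hr⟩ := hF
  obtain ⟨v, hv0, hv, hacc⟩ := hG
  have hl : ∀ i, F.label (r i) = M.run (pref w (m + i)) := by
    intro i
    induction i with
    | zero => exact hr0
    | succ i ih =>
      rw [← add_assoc, M.run_pref_succ, ← ih]
      exact F.label_delta _ _ _ (hr i)
  refine ⟨m, fun i => ⟨(r i, v (m + i)), pref w (m + i), ?_, NBW.mem_reach_of_run hv0 hv _⟩,
    hl, fun i => ⟨hr i, hv (m + i)⟩, frequently_atTop.2 fun N => ?_⟩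
  · rw [hl]; exact (M.label_run _).symm
  · obtain ⟨n, hn, h⟩ := hacc (m + N)
    refine ⟨n - m, by omega, ?_⟩
    have : m + (n - m) = n := by omega
    simpa [this] using h

/-- Once only recurrent states occur, any two of them reach each other, and an accepting vertex is
among them. -/
theorem eventually_kept [Finite P] [Finite V] {w : ℕ → α} {s : ℕ → ProdState F G}
    (hs : ∀ i, prodTrans F G (s i) (w i) (s (i + 1)))
    (hacc : ∃ᶠ i in atTop, (s i).1.2 ∈ G.acc) :
    ∃ N, ∀ i ≥ N, Kept F G (s i) ∧ SameSCC F G (s i) (s (i + 1)) := by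
  obtain ⟨N, hN⟩ := eventually_atTop.1 (eventually_recurrent s)
  have hle : ∀ i j, i ≤ j → Relation.ReflTransGen (prodEdge F G) (s i) (s j) := by
    intro i j hij
    induction j, hij using Nat.le_induction with
    | base => exact .refl
    | succ j _ ih => exact ih.tail ⟨w j, hs j⟩
  have hall : ∀ i ≥ N, ∀ j, Relation.ReflTransGen (prodEdge F G) (s j) (s i) := by
    intro i hi j
    obtain ⟨k, hk, h⟩ := frequently_atTop.1 (hN i hi) j
    rw [← h]; exact hle j k hk
  refine ⟨N, fun i hi => ⟨⟨?_, ?_⟩, hall _ (by omega) _, hall _ hi _⟩⟩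
  · exact Relation.TransGen.head' ⟨w i, hs i⟩ (hall i hi (i + 1))
  · obtain ⟨k, hk, h⟩ := frequently_atTop.1 hacc N
    exact ⟨s k, ⟨hall k hk i, hall i hi k⟩, h⟩

end Product

/-! ### Sparse injections and the first claim -/

/-- A sequence of positions with prescribed minimal gaps. -/
def sparse (K : ℕ → ℕ) : ℕ → ℕ
  | 0 => 0
  | i + 1 => sparse K i + K (sparse K i) + 1

theorem sparse_strictMono (K : ℕ → ℕ) : StrictMono (sparse K) :=
  strictMono_nat_of_lt_succ fun i => by simp only [sparse]; omega

theorem notMem_range_sparse (K : ℕ → ℕ) (i t : ℕ) (h0 : 0 < t) (ht : t ≤ K (sparse K i)) :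
    sparse K i + t ∉ Set.range (sparse K) := by
  rintro ⟨j, hj⟩
  have h1 : i < j := (sparse_strictMono K).lt_iff_lt.1 (by omega)
  have h2 : sparse K (i + 1) ≤ sparse K j := (sparse_strictMono K).monotone h1
  simp only [sparse] at h2
  omega

theorem injectable_subset_productNFW_language {α S P V : Type*} [Finite P] [Finite V]
    {L : Set (ℕ → α)} {M : SLTM L S} (hM : M.IsCanonical) (F : DFW M P) (G : NBW α V) :
    {w : ℕ → α | ∀ J : Set ℕ, J.Infinite → ∃ w', IsSLII L J w w' ∧
      w' ∈ F.language ∩ G.language} ⊆ (productNFW F G).language := by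
  intro w hw
  by_contra hnot
  choose K hK using (productNFW F G).exists_bound_of_notMem_language hnot
  obtain ⟨w', ⟨u, hu0, hu1, hu2⟩, hF, hG⟩ :=
    hw _ (Set.infinite_range_of_injective (sparse_strictMono K).injective)
  have hu : ∀ n, suffixLang L (pref w n ++ u n) = suffixLang L (pref w n) := by
    intro n
    by_cases hn : n ∈ Set.range (sparse K)
    · exact hu1 n hn
    · simp [hu0 n hn]
  obtain ⟨m, s, hl, hs, hacc⟩ := exists_prod_run hF hG
  obtain ⟨N, hN⟩ := eventually_kept hs hacc
  -- Neither `sparse K` nor `injPos` decreases an index, so index `m + N` ensures that the run is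
  -- already in a kept component when it reads `w n`.
  set n := sparse K (m + N) with hn
  have hle : m + N ≤ injPos w u n := (sparse_strictMono K).le_apply.trans (le_injPos w u n)
  obtain ⟨d, hd⟩ := Nat.exists_eq_add_of_le hle
  refine hK n (fun t => ⟨s (N + d + t), (hN _ (by omega)).1⟩) ?_ fun t ht => ?_
  · change F.label (s (N + d)).1.1 = _
    rw [hl, ← add_assoc, ← hd, pref_injPos hu2]
    apply hM.run_eq
    rw [suffixLang_append, suffixLang_injected hu, ← suffixLang_append, hu]
  · refine ⟨?_, (hN (N + d + t) (by omega)).2⟩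
    have h1 : w (n + t) = w' (m + (N + d + t)) := by
      rw [← apply_injPos hu2, injPos_add n t, hd]
      · congr 1; omega
      · exact fun t' h0 ht' => hu0 _ (notMem_range_sparse K _ t' h0 (by rw [← hn]; omega))
    rw [h1]
    exact hs _

/-! ## Determinization -/

/-- The subset construction started in `r 0` always contains the state of the path `r`, so it never
gets stuck. -/
theorem NFW.language_subset_det_language {α S P : Type*} {L : Set (ℕ → α)} {M : SLTM L S}
    (N : NFW M P) : N.language ⊆ N.det.language := by
  rintro w ⟨m, r, h0, hr⟩
  have hmem : ∀ i, r i ∈ (pref (fun i => w (m + i)) i).foldl N.post {r 0} := by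
    intro i
    induction i with
    | zero => simp [pref]
    | succ i ih =>
      rw [pref_succ, List.foldl_append]
      exact ⟨r i, ih, hr i⟩
  refine ⟨m, fun i => ⟨_, ⟨r i, hmem i⟩, r 0, _, rfl⟩, ?_, fun i => ?_⟩
  · rw [← h0]
    change N.label _ = _
    congr 1
    have := Set.Nonempty.some_mem ⟨r 0, hmem 0⟩
    simpa [pref] using this
  · have h : (pref (fun i => w (m + i)) (i + 1)).foldl N.post {r 0} =
        N.post ((pref (fun i => w (m + i)) i).foldl N.post {r 0}) (w (m + i)) := by
      rw [pref_succ, List.foldl_append]; rfl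
    change N.det.delta _ _ = _
    simp only [NFW.det]
    rw [dif_pos (h ▸ ⟨r (i + 1), hmem (i + 1)⟩)]
    simp only [h]

theorem exists_play {Q : Type*} (X : List Q → Set Q) (hX : ∀ h q, (X (h ++ [q])).Nonempty)
    (q : Q) : ∃ p : ℕ → Q, p 0 = q ∧ ∀ i, p (i + 1) ∈ X (pref p (i + 1)) := by
  choose f hf using hX
  let next : List Q → Q → List Q × Q := fun h x => (h ++ [x], f h x)
  let g : ℕ → List Q × Q := fun n => Nat.rec ([], q) (fun _ s => next s.1 s.2) n
  have h1 : ∀ n, (g n).1 = pref (fun n => (g n).2) n := by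
    intro n
    induction n with
    | zero => rfl
    | succ n ih =>
      rw [pref_succ, ← ih]
  refine ⟨fun n => (g n).2, rfl, fun i => ?_⟩
  rw [pref_succ, ← h1]
  exact hf _ _

namespace WAA

variable {α Q : Type*} (A : WAA α Q)

/-! ## Winning strategies of the rejector and plays -/

/-- `p` is a play from `q` in which the rejector follows `R`. -/
def IsPlay (R : List Q → Set Q) (q : Q) (p : ℕ → Q) : Prop :=
  p 0 = q ∧ ∀ i, p (i + 1) ∈ R (pref p (i + 1))

/-- The rejector wins the game on `w` from the state `q` at time `n`. -/
def RejWins (w : ℕ → α) (n : ℕ) (q : Q) : Prop :=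
  ∃ R, A.IsRejStrategy (fun i => w (n + i)) R ∧
    ∀ p, IsPlay R q p → ∃ᶠ i in atTop, p i ∉ A.acc

variable {A}

theorem history_fst (R : List Q → Set Q) (C : List (Set Q) → Q) (n : ℕ) :
    (A.history R C n).1 = pref (A.play R C) (n + 1) := by
  induction n with
  | zero => rfl
  | succ n ih =>
    rw [pref_succ, ← ih]
    simp [history, play]

theorem play_succ (R : List Q → Set Q) (C : List (Set Q) → Q) (n : ℕ) :
    A.play R C (n + 1) = C ((A.history R C n).2 ++ [R (pref (A.play R C) (n + 1))]) := by
  rw [← history_fst]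
  simp [history, play]

theorem history_snd_length (R : List Q → Set Q) (C : List (Set Q) → Q) (n : ℕ) :
    (A.history R C n).2.length = n := by
  induction n with
  | zero => rfl
  | succ n ih => simp [history, ih]

theorem isPlay_play {w : ℕ → α} {R : List Q → Set Q} {C : List (Set Q) → Q}
    (hR : A.IsRejStrategy w R) (hC : IsAccStrategy C) : IsPlay R A.init (A.play R C) := by
  refine ⟨rfl, fun i => ?_⟩
  rw [play_succ]
  refine hC _ _ ?_
  rw [pref_succ]
  exact A.clause_nonempty _ _ _ (hR _ _)

/-- The number of clauses seen reveals the round, so the acceptor can reproduce `p` blindly. Off the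
play, any state of the clause serves. -/
theorem IsPlay.exists_accStrategy {R : List Q → Set Q} {p : ℕ → Q} (hp : IsPlay R A.init p) :
    ∃ C, IsAccStrategy C ∧ A.play R C = p := by
  classical
  let C : List (Set Q) → Q := fun cs =>
    if p cs.length ∈ cs.getLastD ∅ then p cs.length
    else if h : (cs.getLastD ∅).Nonempty then h.some else A.init
  refine ⟨C, fun cs c hc => ?_, ?_⟩
  · simp only [C, List.getLastD_concat]
    split_ifs with h
    · exact h
    · exact hc.some_mem
  · have h : ∀ n, pref (A.play R C) (n + 1) = pref p (n + 1) := by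
      intro n
      induction n with
      | zero => simp [pref, hp.1, play, history]
      | succ n ih =>
        rw [pref_succ _ (n + 1), pref_succ p (n + 1), ih, play_succ, ih]
        have := hp.2 n
        simp [C, history_snd_length, this]
    funext n
    have := h n
    rw [pref_succ, pref_succ p n] at this
    simpa using (List.append_inj' this rfl).2

theorem mem_language_iff {w : ℕ → α} : w ∈ A.language ↔ ¬ A.RejWins w 0 A.init := by
  refine not_congr ⟨?_, ?_⟩
  · rintro ⟨R, hR, h⟩
    refine ⟨R, by simpa using hR, fun p hp => ?_⟩
    obtain ⟨C, hC, rfl⟩ := hp.exists_accStrategy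
    have := h C hC
    rw [← eventually_atTop] at this
    exact not_eventually.1 this
  · rintro ⟨R, hR, h⟩
    refine ⟨R, by simpa using hR, fun C hC => ?_⟩
    rw [← eventually_atTop]
    exact not_eventually.2 (h _ (isPlay_play (by simpa using hR) hC))

/-- A play descends in the preorder, so its recurrent states are equivalent and, by weakness, agree
on acceptance. -/
theorem eventually_acc_or_eventually_notMem [Finite Q] {w : ℕ → α} {R : List Q → Set Q} {q : Q}
    {p : ℕ → Q} (hR : A.IsRejStrategy w R) (hp : IsPlay R q p) :
    (∀ᶠ i in atTop, p i ∈ A.acc) ∨ ∀ᶠ i in atTop, p i ∉ A.acc := by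
  obtain ⟨le, htot, htrans, hstep, hacc⟩ := A.weak
  have hle : ∀ i j, i ≤ j → le (p j) (p i) := by
    intro i j hij
    induction j, hij using Nat.le_induction with
    | base => exact (htot (p i) (p i)).elim id id
    | succ j _ ih =>
      have h1 := hp.2 j
      rw [pref_succ] at h1
      exact htrans _ _ _ (hstep _ _ _ (hR _ _) _ h1) ih
  obtain ⟨N, hN⟩ := eventually_atTop.1 (eventually_recurrent p)
  have h : ∀ i ≥ N, (p i ∈ A.acc ↔ p N ∈ A.acc) := by
    intro i hi
    obtain ⟨j, hj, hjN⟩ := frequently_atTop.1 (hN N le_rfl) i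
    exact hacc _ _ (hle N i hi) (hjN ▸ hle i j hj)
  by_cases hc : p N ∈ A.acc
  · exact .inl (eventually_atTop.2 ⟨N, fun i hi => (h i hi).2 hc⟩)
  · exact .inr (eventually_atTop.2 ⟨N, fun i hi => fun h' => hc ((h i hi).1 h')⟩)

/-- A dual clause is the image of a choice function and thus meets every clause of `A`. Hence one
play follows both strategies; it would visit both accepting and rejecting states infinitely often.
-/
theorem not_rejWins_dual [Finite Q] {w : ℕ → α} {n : ℕ} {q : Q} (h : A.RejWins w n q) :
    ¬ A.dual.RejWins w n q := by
  rintro ⟨R', hR', hwin'⟩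
  obtain ⟨R, hR, hwin⟩ := h
  obtain ⟨p, hp0, hp⟩ := exists_play (fun h => R h ∩ R' h) (fun h q => by
    obtain ⟨g, hg, he⟩ := hR' h q
    refine ⟨g (R (h ++ [q])), hg _ (hR h q), ?_⟩
    rw [he]
    exact Set.mem_image_of_mem g (hR h q)) q
  have h1 := hwin p ⟨hp0, fun i => (hp i).1⟩
  have h2 := hwin' p ⟨hp0, fun i => (hp i).2⟩
  rcases eventually_acc_or_eventually_notMem hR ⟨hp0, fun i => (hp i).1⟩ with h3 | h3
  · obtain ⟨i, hi, hi'⟩ := (h1.and_eventually h3).exists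
    exact hi hi'
  · obtain ⟨i, hi, hi'⟩ := (h2.and_eventually h3).exists
    exact hi hi'

/-! ## Bounded attractors -/

variable (A) in
/-- The states of `U n` from which the acceptor can force a visit to an accepting state within
`k` rounds while staying in `U`, where the word `w` is read from time `n` on. -/
def attr (w : ℕ → α) (U : ℕ → Set Q) : ℕ → ℕ → Set Q
  | 0, n => U n ∩ A.acc
  | k + 1, n => attr w U k n ∪
      {q | q ∈ U n ∧ ∀ c ∈ A.trans q (w n), ∃ q' ∈ c, q' ∈ attr w U k (n + 1)}

variable {w : ℕ → α} {U : ℕ → Set Q}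

theorem attr_subset (k n : ℕ) : A.attr w U k n ⊆ U n := by
  induction k with
  | zero => exact Set.inter_subset_left
  | succ k ih => exact Set.union_subset ih fun q hq => hq.1

theorem attr_monotone (n : ℕ) : Monotone fun k => A.attr w U k n :=
  monotone_nat_of_le_succ fun _ => Set.subset_union_left

theorem exists_mem_attr_pred {k n : ℕ} {q : Q} (hq : q ∈ A.attr w U k n) (hacc : q ∉ A.acc)
    {c : Set Q} (hc : c ∈ A.trans q (w n)) : ∃ q' ∈ c, q' ∈ A.attr w U (k - 1) (n + 1) := by
  induction k with
  | zero => exact absurd hq.2 hacc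
  | succ k ih =>
    rcases hq with hq | hq
    · obtain ⟨q', h1, h2⟩ := ih hq
      exact ⟨q', h1, attr_monotone (n + 1) (by omega) h2⟩
    · exact hq.2 c hc

theorem exists_attr_bound [Finite Q] (A : WAA α Q) (w : ℕ → α) (U : ℕ → Set Q) (n : ℕ) :
    ∃ K, ∀ k, A.attr w U k n ⊆ A.attr w U K n := by
  obtain ⟨K, hK⟩ := WellFoundedGT.monotone_chain_condition
    (⟨fun k => A.attr w U k n, attr_monotone n⟩ : ℕ →o Set Q)
  refine ⟨K, fun k => ?_⟩
  rcases le_total K k with h | h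
  · exact (hK k h).ge
  · exact attr_monotone n h

/-- The number of rounds depends on the clause and the chosen state; finiteness of `Q` gives one
bound for all of them. -/
theorem mem_attr_of_forall_clause [Finite Q] {n : ℕ} {q : Q} (hq : q ∈ U n)
    (h : ∀ c ∈ A.trans q (w n), ∃ q' ∈ c, ∃ k, q' ∈ A.attr w U k (n + 1)) :
    ∃ k, q ∈ A.attr w U k n := by
  obtain ⟨K, hK⟩ := A.exists_attr_bound w U (n + 1)
  refine ⟨K + 1, .inr ⟨hq, fun c hc => ?_⟩⟩
  obtain ⟨q', h1, k, h2⟩ := h c hc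
  exact ⟨q', h1, hK k h2⟩

/-! ## Completeness of the breakpoint construction -/

open Classical in
/-- Obligation sets, with bounds on the time until they are fulfilled. -/
noncomputable def obligations (A : WAA α Q) (w : ℕ → α) (U : ℕ → Set Q) (K : ℕ → ℕ) :
    ℕ → Set Q × ℕ
  | 0 => (∅, 0)
  | n + 1 =>
    if (obligations A w U K n).1 = ∅ then (U (n + 1) \ A.acc, K (n + 1))
    else (A.attr w U ((obligations A w U K n).2 - 1) (n + 1) \ A.acc,
      (obligations A w U K n).2 - 1)

/-- The first component follows `U`. The counter of a nonempty obligation set drops in each round,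
and at 0 the set is empty, since `attr` at 0 contains accepting states only. -/
theorem mem_miyanoHayashi_language_of_attr [Finite Q] (hinit : A.init ∈ U 0)
    (hU : ∀ n, ∀ q ∈ U n, ∀ c ∈ A.trans q (w n), ∃ q' ∈ c, ∃ k, q' ∈ A.attr w U k (n + 1)) :
    w ∈ A.miyanoHayashi.language := by
  choose K hK using A.exists_attr_bound w U
  have hUK : ∀ n, U n ⊆ A.attr w U (K n) n := fun n q hq =>
    (mem_attr_of_forall_clause hq (hU n q hq)).elim fun k hk => hK n k hk
  set o := obligations A w U K with ho
  have hstep0 : ∀ n, (o n).1 = ∅ → o (n + 1) = (U (n + 1) \ A.acc, K (n + 1)) := by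
    intro n hn
    rw [ho] at hn ⊢
    rw [obligations, if_pos hn]
  have hstep1 : ∀ n, (o n).1 ≠ ∅ → o (n + 1) =
      (A.attr w U ((o n).2 - 1) (n + 1) \ A.acc, (o n).2 - 1) := by
    intro n hn
    rw [ho] at hn ⊢
    rw [obligations, if_neg hn]
  have hinv : ∀ n, (o n).1 ⊆ A.attr w U (o n).2 n \ A.acc := by
    intro n
    rcases n with _ | n
    · simp [ho, obligations]
    · by_cases hn : (o n).1 = ∅
      · rw [hstep0 n hn]
        exact Set.sdiff_subset_sdiff_left (hUK _)
      · rw [hstep1 n hn]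
  have hfin : ∀ k n, (o n).2 = k → ∃ m ≥ n, (o m).1 = ∅ := by
    intro k
    induction k with
    | zero =>
      intro n hn
      refine ⟨n, le_rfl, Set.eq_empty_of_forall_notMem fun q hq => ?_⟩
      have := hinv n hq
      rw [hn] at this
      exact this.2 this.1.2
    | succ k ih =>
      intro n hn
      by_cases he : (o n).1 = ∅
      · exact ⟨n, le_rfl, he⟩
      · obtain ⟨m, hm, h⟩ := ih (n + 1) (by rw [hstep1 n he]; simp [hn])
        exact ⟨m, by omega, h⟩
  -- The initial vertex must be exactly `{A.init}`, whereas `U 0` may be larger.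
  let T : ℕ → Set Q := fun n => if n = 0 then {A.init} else U n
  have hT : ∀ n, T n ⊆ U n := by
    intro n
    rcases n with _ | n
    · simpa [T] using hinit
    · simp [T]
  refine ⟨fun n => (T n, (o n).1), ?_, fun n => ⟨fun q hq c hc => ?_, ?_⟩, fun N => hfin _ N rfl⟩
  · simp [miyanoHayashi, T, ho, obligations]
  · obtain ⟨q', h1, k, h2⟩ := hU n q (hT n hq) c hc
    exact ⟨q', attr_subset k _ h2, h1⟩
  · by_cases hn : (o n).1 = ∅
    · left
      refine ⟨hn, ?_⟩
      simp [hstep0 n hn, T]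
    · right
      refine ⟨hn, A.attr w U ((o n).2 - 1) (n + 1), attr_subset _ _, fun q hq c hc => ?_, ?_⟩
      · obtain ⟨h1, h2⟩ := hinv n hq
        obtain ⟨q', h3, h4⟩ := exists_mem_attr_pred h1 h2 hc
        exact ⟨q', h4, h3⟩
      · simp [hstep1 n hn]

/-! ## Forcing accepting states from positions not won by the rejector -/

section Switch

open Classical in
/-- The strategy of the rejector that follows the positional strategy `c` until a position in
which the rejector wins is reached, and the strategy `σ` for that position from then on. -/
noncomputable def switchStrategy (W : ℕ → Q → Prop) (c : ℕ → Q → Set Q)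
    (σ : ℕ → Q → List Q → Set Q) : ℕ → List Q → Set Q
  | _, [] => ∅
  | m, q :: h =>
    if W m q then σ m q (q :: h)
    else if h = [] then c m q else switchStrategy W c σ (m + 1) h

variable {W : ℕ → Q → Prop} {c : ℕ → Q → Set Q} {σ : ℕ → Q → List Q → Set Q}

theorem isRejStrategy_switchStrategy (hc : ∀ m q, c m q ∈ A.trans q (w m))
    (hσ : ∀ m q, W m q → A.IsRejStrategy (fun i => w (m + i)) (σ m q)) (m : ℕ) :
    A.IsRejStrategy (fun i => w (m + i)) (switchStrategy W c σ m) := by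
  intro h q
  induction h generalizing m with
  | nil =>
    simp only [List.nil_append, switchStrategy]
    split_ifs with hW
    · exact hσ m q hW [] q
    · exact hc m q
  | cons q₀ h ih =>
    simp only [List.cons_append, switchStrategy]
    split_ifs with hW hnil
    · exact hσ m q₀ hW (q₀ :: h) q
    · simp at hnil
    · have := ih (m + 1)
      simp only [List.length_cons]
      rwa [show m + (h.length + 1) = m + 1 + h.length by omega]

theorem IsPlay.switchStrategy_tail {m : ℕ} {q : Q} {p : ℕ → Q}
    (hp : IsPlay (switchStrategy W c σ m) q p) (hW : ¬ W m (p 0)) :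
    p 1 ∈ c m (p 0) ∧
      IsPlay (switchStrategy W c σ (m + 1)) (p 1) (fun i => p (i + 1)) := by
  refine ⟨by simpa [pref, switchStrategy, hW] using hp.2 0, rfl, fun i => ?_⟩
  have h := hp.2 (i + 1)
  rw [pref_succ_eq_cons, switchStrategy, if_neg hW, if_neg] at h
  · exact h
  · rw [pref_succ]; simp

theorem IsPlay.switchStrategy_drop {m : ℕ} {q : Q} {p : ℕ → Q}
    (hp : IsPlay (switchStrategy W c σ m) q p) (k : ℕ) (hW : ∀ i < k, ¬ W (m + i) (p i)) :
    IsPlay (switchStrategy W c σ (m + k)) (p k) (fun i => p (i + k)) := by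
  induction k with
  | zero => exact ⟨rfl, hp.2⟩
  | succ k ih =>
    have h := ((ih fun i hi => hW i (by omega)).switchStrategy_tail
      (by simpa using hW k (by omega))).2
    have e : ∀ i, i + 1 + k = i + (k + 1) := fun i => by omega
    simp only [e] at h
    exact ⟨by simp, h.2⟩

/-- Only the head of the history is tested first, so once a won position is the head, `σ` is
followed forever. -/
theorem IsPlay.of_switchStrategy {m : ℕ} {q : Q} {p : ℕ → Q}
    (hp : IsPlay (switchStrategy W c σ m) q p) (hW : W m q) : IsPlay (σ m q) q p := by
  refine ⟨hp.1, fun i => ?_⟩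
  have h := hp.2 i
  rw [pref_succ_eq_cons, hp.1, switchStrategy, if_pos hW] at h
  rwa [pref_succ_eq_cons, hp.1]

end Switch

/-- If the clause `d` had no such state, the rejector would win from `q`: it picks clauses that
avoid the attractor and switches to a winning strategy as soon as a won position appears. -/
theorem exists_mem_attr_of_not_rejWins [Finite Q] {n : ℕ} {q : Q} (hq : ¬ A.RejWins w n q)
    {d : Set Q} (hd : d ∈ A.trans q (w n)) :
    ∃ q' ∈ d, ∃ k, q' ∈ A.attr w (fun m => {q | ¬ A.RejWins w m q}) k (n + 1) := by
  classical
  by_contra! hstuck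
  set U : ℕ → Set Q := fun m => {q | ¬ A.RejWins w m q} with hUdef
  have hex : ∀ m q, ∃ c ∈ A.trans q (w m),
      (∃ c ∈ A.trans q (w m), ∀ q' ∈ c, ∀ k, q' ∉ A.attr w U k (m + 1)) →
        ∀ q' ∈ c, ∀ k, q' ∉ A.attr w U k (m + 1) := by
    intro m q
    by_cases h : ∃ c ∈ A.trans q (w m), ∀ q' ∈ c, ∀ k, q' ∉ A.attr w U k (m + 1)
    · obtain ⟨c, h1, h2⟩ := h
      exact ⟨c, h1, fun _ => h2⟩
    · obtain ⟨c, h1⟩ := A.trans_nonempty q (w m)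
      exact ⟨c, h1, fun h' => absurd h' h⟩
  choose c hc hc' using hex
  have hσ : ∀ m q, ∃ R, A.RejWins w m q → A.IsRejStrategy (fun i => w (m + i)) R ∧
      ∀ p, IsPlay R q p → ∃ᶠ i in atTop, p i ∉ A.acc := by
    intro m q
    by_cases h : A.RejWins w m q
    · exact h.imp fun R hR _ => hR
    · exact ⟨fun _ => ∅, fun h' => absurd h' h⟩
  choose σ hσ using hσ
  refine hq ⟨switchStrategy (A.RejWins w) c σ n,
    isRejStrategy_switchStrategy hc (fun m q h => (hσ m q h).1) n, fun p hp => ?_⟩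
  by_cases hex : ∃ k, A.RejWins w (n + k) (p k)
  · have h1 := hp.switchStrategy_drop (Nat.find hex) fun i hi => Nat.find_min hex hi
    have hW := Nat.find_spec hex
    have h2 := (hσ _ _ hW).2 _ (h1.of_switchStrategy hW)
    -- Winning does not depend on the finitely many rounds before the switch.
    exact (tendsto_add_atTop_nat (Nat.find hex)).frequently h2
  · push Not at hex
    have hmem : ∀ i, p (i + 1) ∈ c (n + i) (p i) := by
      intro i
      simpa [add_comm] using ((hp.switchStrategy_drop i fun j _ => hex j).switchStrategy_tail
        (by simpa using hex i)).1
    have hout : ∀ i, ∀ k, p (i + 1) ∉ A.attr w U k (n + i + 1) := by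
      intro i
      induction i with
      | zero =>
        refine hc' _ _ ?_ _ (hmem 0)
        exact ⟨d, by rw [hp.1]; exact hd, hstuck⟩
      | succ i ih =>
        refine hc' _ _ ?_ _ (hmem (i + 1))
        -- If every clause met the attractor, the current state would belong to it itself.
        by_contra! hcon
        obtain ⟨k, hk⟩ := mem_attr_of_forall_clause (U := U) (hex (i + 1)) hcon
        exact ih k hk
    -- The start `q` may be accepting; avoidance begins with its successor.
    refine (eventually_atTop.2 ⟨1, fun i hi hacc => ?_⟩).frequently
    obtain ⟨j, rfl⟩ := Nat.exists_eq_add_of_le' hi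
    exact hout j 0 ⟨hex (j + 1), hacc⟩

theorem mem_miyanoHayashi_language [Finite Q] (h : ¬ A.RejWins w 0 A.init) :
    w ∈ A.miyanoHayashi.language :=
  mem_miyanoHayashi_language_of_attr (U := fun m => {q | ¬ A.RejWins w m q}) h
    fun _ _ hq _ hc => exists_mem_attr_of_not_rejWins hq hc

theorem subset_obligationGraph_language [Finite Q] (A : WAA α Q) (ℓ : ℕ) :
    (if Odd ℓ then A.languageᶜ else A.language) ⊆ (A.obligationGraph ℓ).language := by
  intro w hw
  unfold obligationGraph
  split_ifs at hw ⊢ with h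
  · rw [Set.mem_compl_iff, mem_language_iff, not_not] at hw
    exact mem_miyanoHayashi_language (A := A.dual) (not_rejWins_dual hw)
  · exact mem_miyanoHayashi_language (mem_language_iff.1 hw)

end WAA

/-! ## Levels of the canonical chain -/

theorem level_antitone {α : Type*} (L : Set (ℕ → α)) : Antitone (level L) :=
  antitone_nat_of_succ_le fun _ _ hw => hw.1

/-- The strict bound by `n` extracts a level index above `n` from the supremum, whether or not it is
attained; the levels decrease. -/
theorem mem_level_of_le_naturalColor {α : Type*} {L : Set (ℕ → α)} {w : ℕ → α} {n : ℕ}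
    (h : ((n + 1 : ℕ) : ℕ∞) ≤ naturalColor L w) : w ∈ level L (n + 1) := by
  have h1 : (n : ℕ∞) < naturalColor L w :=
    lt_of_lt_of_le (by exact_mod_cast n.lt_succ_self) h
  simp only [naturalColor, lt_iSup_iff] at h1
  obtain ⟨i, hi, hlt⟩ := h1
  exact level_antitone L (Nat.succ_le_of_lt (by exact_mod_cast hlt)) hi

section Levels

variable {α Q S : Type*} [Finite Q] {A : WAA α Q} {M : SLTM A.language S}

theorem injectable_subset_floatN_language (hM : M.IsCanonical) (ℓ : ℕ) {P : Type*} [Finite P]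
    (F : DFW M P) :
    {w : ℕ → α | ∀ J : Set ℕ, J.Infinite → ∃ w', IsSLII A.language J w w' ∧
      w' ∈ F.language ∩ (A.obligationGraph ℓ).language} ⊆ (A.floatN ℓ F).language :=
  injectable_subset_productNFW_language hM F (A.obligationGraph ℓ)

/-- The witnesses `w'` in the definition of the level satisfy the condition of the first claim,
because both languages there are only enlarged. -/
theorem level_succ_subset_floatN_language (hM : M.IsCanonical) {n : ℕ} {P : Type*} [Finite P]
    {F : DFW M P} (hF : level A.language n ⊆ F.language) :
    level A.language (n + 1) ⊆ (A.floatN (n + 1) F).language := by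
  intro w hw
  refine injectable_subset_floatN_language hM (n + 1) F fun J hJ => ?_
  obtain ⟨w', h1, h2, h3⟩ := hw.2 J hJ
  exact ⟨w', h1, hF h2, A.subset_obligationGraph_language (n + 1) h3⟩

theorem IsLevelChain.level_subset_language (hM : M.IsCanonical) {P : ℕ → Type*}
    [∀ i, Finite (P i)] {F : ∀ i, DFW M (P i)} {n : ℕ} (hF : IsLevelChain A M F n) :
    ∀ i ≤ n, level A.language i ⊆ (F i).language := by
  intro i
  induction i with
  | zero => intro _; rw [hF.1]; exact Set.subset_univ _
  | succ i ih =>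
    intro hi
    rw [hF.2 i (by omega)]
    exact (level_succ_subset_floatN_language hM (ih (by omega))).trans
      (NFW.language_subset_det_language _)

end Levels

end Cocoa

theorem mainTheorem3 {α Q S : Type*} [Finite Q] (A : Cocoa.WAA α Q)
    (M : Cocoa.SLTM A.language S) (hM : M.IsCanonical) :
    (∀ (ℓ : ℕ), 1 ≤ ℓ → ∀ (P : Type*) [Finite P] (F : Cocoa.DFW M P),
      {w : ℕ → α | ∀ J : Set ℕ, J.Infinite →
        ∃ w', Cocoa.IsSLII A.language J w w' ∧
          w' ∈ F.language ∩ (A.obligationGraph ℓ).language} ⊆ (A.floatN ℓ F).language) ∧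
    (∀ (ℓ : ℕ), 1 ≤ ℓ → ∀ (P : ℕ → Type*) [∀ i, Finite (P i)] (F : ∀ i, Cocoa.DFW M (P i)),
      Cocoa.IsLevelChain A M F (ℓ - 1) →
        ∀ w : ℕ → α, (ℓ : ℕ∞) ≤ Cocoa.naturalColor A.language w →
          w ∈ (A.floatN ℓ (F (ℓ - 1))).language) := by
  refine ⟨fun ℓ _ P _ F => Cocoa.injectable_subset_floatN_language hM ℓ F,
    fun ℓ hℓ P _ F hF w hw => ?_⟩
  obtain ⟨n, rfl⟩ := Nat.exists_eq_add_of_le' hℓ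
  exact Cocoa.level_succ_subset_floatN_language hM (hF.level_subset_language hM n le_rfl)
    (Cocoa.mem_level_of_le_naturalColor hw)
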